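/- Let $\mathfrak c$ be the cardinality of the continuum, identified with the set of ordinals below it. For a set $X$ let $\mathbb Z^{(X)}$ be the group of finitely supported functions $X\to\mathbb Z$ (similarly $\mathbb Q^{(X)}$), let $\chi_\beta$ be the function with support $\{\beta\}$ and $\chi_\beta(\beta)=1$, and for $T\subseteq\mathfrak c$ regard $\mathbb Z^{(T)}$ as the subgroup of $\mathbb Z^{(\mathfrak c)}$ of all elements with support contained in $T$. Let $\mathbb T=\mathbb R/\mathbb Z$ with its usual topology. Let $\mathcal U$ be a selective ultrafilter on $\omega$, i.e. a free ultrafilter such that for each partition $\{A_n:n\in\omega\}$ of $\omega$ into non-empty sets, either $A_n\in\mathcal U$ for some $n$, or there are $a_n\in A_n$ $(n\in\omega)$ with $\{a_n:n\in\omega\}\in\mathcal U$. For a sequence $f$ let $[f]_{\mathcal U}$ denote its class modulo equality on a set in $\mathcal U$. Let $(h_\xi)_{0<\xi<\mathfrak c}$ be an enumeration (possibly with repetitions) of all injective sequences $\omega\to\mathbb Z^{(\mathfrak c)}$ such that $\bigcup_{n\in\omega}\operatorname{supp}h_\xi(n)\subseteq\xi$ for every $\xi$. Let $(\sigma_\xi)_{0<\xi<\mathfrak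 c}$ be permutations of $\omega$ such that the classes $[h_\xi\circ\sigma_\xi]_{\mathcal U}$ $(0<\xi<\mathfrak c)$ together with the classes of the constant sequences with value $\chi_\beta$ $(\beta<\mathfrak c)$ form a linearly independent family in the $\mathbb Q$-vector space $(\mathbb Q^{(\mathfrak c)})^\omega/\mathcal U$. Let $c$ and $c_p$ $(p\in\omega)$ be nonzero elements of $\mathbb Z^{(\mathfrak c)}$, and let $u_p$ $(p\in\omega)$ be pairwise distinct members of $\{h_\xi\circ\sigma_\xi:0<\xi<\mathfrak c\}$. Let $T\subseteq\mathfrak c$ be a countable set with $$\operatorname{supp}c\;\cup\;\bigcup_{p\in\omega}\operatorname{supp}c_p\;\cup\;\bigcup_{p,n\in\omega}\operatorname{supp}u_p(n)\subseteq T .$$ Then there is a group homomorphism $\Lambda:\mathbb Z^{(T)}\to\mathbb T$ such that 1. $\Lambda(c)\neq0$, and 2. for every $p\in\omega$, $\mathcal U\text{-}\lim_{n}\Lambda(u_p(n))=\Lambda(c_p)$, i.e. $\{n\in\omega:\Lambda(u_p(n))\in V\}\in\mathcal U$ for every neighbourhood $V$ of $\Lambda(c_p)$. -/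

import Mathlib

/-- The set of all ordinals below the cardinal `𝔠`. -/
abbrev BelowCont : Type 1 := Set.Iio (Cardinal.continuum.{0}.ord)

/-- The set `𝔠 \ {0}` of all nonzero ordinals below `𝔠`. -/
abbrev BelowContPos : Type 1 := Set.Ioo (0 : Ordinal.{0}) Cardinal.continuum.{0}.ord

/-- The free Abelian group `ℤ^(𝔠)` of finitely supported functions `𝔠 → ℤ`. -/
abbrev FreeAbCont : Type 1 := BelowCont →₀ ℤ

/-- The rational vector space `ℚ^(𝔠)`. -/
abbrev RatCont : Type 1 := BelowCont →₀ ℚ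

/-- The subgroup `ℤ^(T)` of `ℤ^(𝔠)`: all elements whose support is contained in `T`. -/
abbrev FreeAbOn (T : Set BelowCont) : Submodule ℤ FreeAbCont := Finsupp.supported ℤ ℤ T

/-- A selective ultrafilter on `ω`: a free ultrafilter such that every partition of `ω` into
nonempty sets `A 0, A 1, …` has a piece in the ultrafilter or a selector whose set of values is in
the ultrafilter. -/
structure IsSelective (U : Ultrafilter ℕ) : Prop where
  free : ∀ n : ℕ, ({n} : Set ℕ) ∉ U
  selector : ∀ A : ℕ → Set ℕ, (∀ n, (A n).Nonempty) → Pairwise (Function.onFun Disjoint A) →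
    (⋃ n, A n) = Set.univ →
    (∃ n, A n ∈ U) ∨ ∃ a : ℕ → ℕ, (∀ n, a n ∈ A n) ∧ Set.range a ∈ U

/-- `(h ξ)`, for `0 < ξ < 𝔠`, enumerates the injective sequences in `ℤ^(𝔠)` (repetitions are
allowed) in such a way that the supports of all terms of `h ξ` consist of ordinals below `ξ`. -/
structure IsEnumeration (h : BelowContPos → ℕ → FreeAbCont) : Prop where
  range_eq : Set.range h = {f : ℕ → FreeAbCont | Function.Injective f}
  support_lt : ∀ (ξ : BelowContPos) (n : ℕ), ∀ β ∈ (h ξ n).support, (β : Ordinal.{0}) < ξ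

/-- The inclusion of `ℤ^(𝔠)` into `ℚ^(𝔠)`. -/
noncomputable def toRat : FreeAbCont →+ RatCont :=
  Finsupp.mapRange.addMonoidHom (Int.castAddHom ℚ)

/-- The class of a sequence in `ℤ^(𝔠)` in the ultrapower `(ℚ^(𝔠))^ω / U`. -/
noncomputable def ultraClass (U : Ultrafilter ℕ) (f : ℕ → FreeAbCont) :
    Filter.Germ (U : Filter ℕ) RatCont :=
  ((fun n => toRat (f n) : ℕ → RatCont) : Filter.Germ (U : Filter ℕ) RatCont)

/-- The classes of the permuted sequences `h ξ ∘ σ ξ`, for `0 < ξ < 𝔠`, together with the classes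
of the constant sequences with value `χ_β`, for `β < 𝔠`, form a family that is linearly independent
over `ℚ` in the ultrapower `(ℚ^(𝔠))^ω / U`. -/
def IndependentPermutations (U : Ultrafilter ℕ) (h : BelowContPos → ℕ → FreeAbCont)
    (σ : BelowContPos → Equiv.Perm ℕ) : Prop :=
  LinearIndependent ℚ
    (Sum.elim (fun ξ : BelowContPos => ultraClass U (h ξ ∘ σ ξ))
      (fun β : BelowCont => ultraClass U (fun _ => Finsupp.single β 1)))

/-! A homomorphism from a free Abelian group to `ℝ/ℤ` is a point of a compact torus, so `Λ` is
sought in a decreasing intersection of closures of nonempty open sets, starting from the open set of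
points not killing `c`.

Independence makes every nontrivial combination of finitely many `u p n` and a constant nonzero for
almost all `n`. Nontrivial characters have Haar integral zero, so a Weyl-type argument
(`eventually_exists_torusPairing_mem`) makes the joint values of `u p n` and finitely many
coordinates meet any given open set for almost all `n`. Hence an open set can be shrunk so that `u p
n` is close to `c p` for all `p < m` (`eventually_exists_open_refinement`).

Each shrinking serves a single `n`, and the admissible `n` depend on the earlier choices.
Selectivity overcomes this: by `IsSelective.exists_play`, the successive `n` can be chosen to fill a
member of `U`. Compactness then gives the point. -/

/-! ### Combinatorics of selective ultrafilters -/

/-- A set in a selective ultrafilter is infinite. -/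
theorem IsSelective.infinite {U : Ultrafilter ℕ} (hU : IsSelective U) {A : Set ℕ} (hA : A ∈ U) :
    A.Infinite := by
  intro hfin
  have h2 : (⋃ n ∈ A, ({n} : Set ℕ)) ∈ U := by simpa using hA
  obtain ⟨n, -, hn⟩ := (Ultrafilter.finite_biUnion_mem_iff hfin).1 h2
  exact hU.free n hn

theorem IsSelective.compl_mem_of_finite {U : Ultrafilter ℕ} (hU : IsSelective U) {A : Set ℕ}
    (hA : A.Finite) : Aᶜ ∈ U :=
  Ultrafilter.compl_mem_iff_notMem.2 fun h => hU.infinite h hA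

/-- Modulo a selective ultrafilter every function on `ℕ` is constant or injective. -/
theorem IsSelective.const_or_injOn {U : Ultrafilter ℕ} (hU : IsSelective U) (f : ℕ → ℕ) :
    (∃ m, f ⁻¹' {m} ∈ U) ∨ ∃ A ∈ U, Set.InjOn f A := by
  by_cases hfin : (Set.range f).Finite
  · left
    have h2 : (⋃ m ∈ Set.range f, f ⁻¹' {m}) ∈ U := by
      have h3 : (⋃ m ∈ Set.range f, f ⁻¹' {m}) = Set.univ := by ext n; simp
      rw [h3]
      exact Filter.univ_mem
    obtain ⟨m, -, hm⟩ := (Ultrafilter.finite_biUnion_mem_iff hfin).1 h2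
    exact ⟨m, hm⟩
  · have hinf : (Set.range f).Infinite := hfin
    -- The selector property needs nonempty pieces indexed by `ℕ`, so the fibres are indexed by an
    -- enumeration of the range.
    set r := Nat.nth (· ∈ Set.range f) with hr
    have hmono : StrictMono r := Nat.nth_strictMono hinf
    have hran : Set.range r = Set.range f := Nat.range_nth_of_infinite hinf
    have hne : ∀ n, (f ⁻¹' {r n}).Nonempty := fun n =>
      (hran ▸ Set.mem_range_self n : r n ∈ Set.range f)
    have hdisj : Pairwise (Function.onFun Disjoint fun n => f ⁻¹' {r n}) := fun i j hij =>
      Set.disjoint_left.2 fun x hx hx' =>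
        hij (hmono.injective ((show f x = r i from hx).symm.trans hx'))
    have hcover : (⋃ n, f ⁻¹' {r n}) = Set.univ := by
      ext x
      obtain ⟨n, hn⟩ : f x ∈ Set.range r := hran ▸ Set.mem_range_self x
      simpa using ⟨n, hn.symm⟩
    rcases hU.selector _ hne hdisj hcover with ⟨n, hn⟩ | ⟨a, ha, haU⟩
    · exact Or.inl ⟨r n, hn⟩
    · refine Or.inr ⟨_, haU, ?_⟩
      rintro _ ⟨i, rfl⟩ _ ⟨j, rfl⟩ hij
      have hi : f (a i) = r i := ha i
      have hj : f (a j) = r j := ha j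
      rw [hi, hj] at hij
      rw [hmono.injective hij]

/-- A selective ultrafilter contains a pseudo-intersection of every sequence of its members. -/
theorem IsSelective.exists_pseudoIntersection {U : Ultrafilter ℕ} (hU : IsSelective U)
    {B : ℕ → Set ℕ} (hB : ∀ m, B m ∈ U) :
    ∃ A ∈ U, ∀ m, (A \ B m).Finite := by
  classical
  -- Cutting off `[0, m]` ensures that every `n` leaves some `C m`; the first such `m` is the
  -- function made injective below.
  set C : ℕ → Set ℕ := fun m => B m ∩ Set.Ioi m with hC
  have hCU : ∀ m, C m ∈ U := fun m => by
    refine Filter.inter_mem (hB m) ?_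
    have := hU.compl_mem_of_finite (Set.finite_Iic m)
    rwa [Set.compl_Iic] at this
  have hex : ∀ n, ∃ m, n ∉ C m := fun n => ⟨n, fun h => lt_irrefl n h.2⟩
  rcases hU.const_or_injOn (fun n => Nat.find (hex n)) with ⟨m, hm⟩ | ⟨A, hA, hinj⟩
  · obtain ⟨n, hn, hn'⟩ := (hU.infinite (Filter.inter_mem hm (hCU m))).nonempty
    have : Nat.find (hex n) = m := hn
    exact absurd (this ▸ hn') (Nat.find_spec (hex n))
  · refine ⟨A, hA, fun m => ?_⟩
    have hfin : (A ∩ {n | Nat.find (hex n) ≤ m}).Finite := by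
      refine Set.Finite.of_finite_image (f := fun n => Nat.find (hex n)) ?_
        (hinj.mono Set.inter_subset_left)
      refine (Set.finite_Iic m).subset ?_
      rintro _ ⟨n, hn, rfl⟩
      exact hn.2
    refine hfin.subset fun n hn => ⟨hn.1, ?_⟩
    exact Nat.find_min' (hex n) fun h => hn.2 h.1

/-- A selective ultrafilter is closed under diagonal intersections, up to passing to a subset. -/
theorem IsSelective.exists_diagonal {U : Ultrafilter ℕ} (hU : IsSelective U)
    {B : ℕ → Set ℕ} (hB : ∀ m, B m ∈ U) :
    ∃ A ∈ U, ∀ i ∈ A, ∀ j ∈ A, i < j → j ∈ B i := by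
  classical
  set C : ℕ → Set ℕ := fun m => ⋂ i ∈ Set.Iic m, B i with hC
  have hCU : ∀ m, C m ∈ U := fun m =>
    (Filter.biInter_mem (Set.finite_Iic m)).2 fun i _ => hB i
  have hanti : Antitone C := fun a b hab =>
    Set.biInter_subset_biInter_left (Set.Iic_subset_Iic.2 hab)
  have hCB : ∀ m, C m ⊆ B m := fun m => Set.biInter_subset_of_mem (Set.mem_Iic.2 le_rfl)
  obtain ⟨A, hA, hAfin⟩ := hU.exists_pseudoIntersection hCU
  have hG : ∀ m, ∃ g, m < g ∧ ∀ n ∈ A, g ≤ n → n ∈ C m := fun m => by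
    obtain ⟨b, hb⟩ := (hAfin m).bddAbove
    refine ⟨max (m + 1) (b + 1), by omega, fun n hn hle => ?_⟩
    by_contra hcon
    have : n ≤ b := hb ⟨hn, hcon⟩
    omega
  choose G hGlt hG using hG
  -- The points `x k` cut `ℕ` into intervals, and `f n` below is the index of the interval
  -- containing `n`.
  set x : ℕ → ℕ := fun k => G^[k] 0 with hx
  have hxs : ∀ k, x (k + 1) = G (x k) := fun k => Function.iterate_succ_apply' G k 0
  have hxmono : StrictMono x := strictMono_nat_of_lt_succ fun k => by rw [hxs]; exact hGlt _
  have hex : ∀ n, ∃ k, n < x (k + 1) := fun n => ⟨n, hxmono.id_le (n + 1)⟩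
  set f : ℕ → ℕ := fun n => Nat.find (hex n) with hf
  have hf1 : ∀ n, n < x (f n + 1) := fun n => Nat.find_spec (hex n)
  have hf2 : ∀ n, x (f n) ≤ n := fun n => by
    rcases Nat.eq_zero_or_pos (f n) with h0 | hpos
    · rw [h0]; exact Nat.zero_le _
    · have := Nat.find_min (hex n) (m := f n - 1) (Nat.sub_lt hpos one_pos)
      rw [show f n - 1 + 1 = f n by omega] at this
      exact not_lt.1 this
  have hfmono : Monotone f := fun a b hab =>
    Nat.find_min' (hex a) (hab.trans_lt (hf1 b))
  have hinj : ∃ A ∈ U, Set.InjOn f A := by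
    rcases hU.const_or_injOn f with ⟨m, hm⟩ | h
    · refine absurd ?_ (hU.infinite hm)
      refine (Set.finite_Iio (x (m + 1))).subset fun n hn => ?_
      have h1 : f n = m := hn
      exact h1 ▸ hf1 n
    · exact h
  obtain ⟨A', hA', hinj⟩ := hinj
  -- Distinct interval indices of equal parity differ by at least 2, which leaves a whole interval
  -- between `i` and `j`, so that `j ≥ G (x (f i + 1))`.
  have hpar : ∃ D ∈ U, ∀ i ∈ D, ∀ j ∈ D, f i % 2 = f j % 2 := by
    rcases U.mem_or_compl_mem {n | f n % 2 = 0} with h | h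
    · exact ⟨_, h, fun i hi j hj => hi.trans hj.symm⟩
    · refine ⟨_, h, fun i hi j hj => ?_⟩
      have h1 : ¬ f i % 2 = 0 := hi
      have h2 : ¬ f j % 2 = 0 := hj
      omega
  obtain ⟨D, hD, hpar⟩ := hpar
  refine ⟨A ∩ (A' ∩ D), Filter.inter_mem hA (Filter.inter_mem hA' hD), ?_⟩
  rintro i ⟨-, hi', hiD⟩ j ⟨hj, hj', hjD⟩ hij
  have h1 : f i ≤ f j := hfmono hij.le
  have h2 : f i ≠ f j := fun h => hij.ne (hinj hi' hj' h)
  have h3 := hpar i hiD j hjD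
  have h4 : f i + 2 ≤ f j := by omega
  have h5 : G (x (f i + 1)) ≤ j := by
    rw [← hxs]
    exact (hxmono.monotone h4).trans (hf2 j)
  exact hCB i (hanti (hf1 i).le (hG _ j hj h5))

/-- The first player has no winning strategy in the ultrafilter game of a selective ultrafilter:
if in state `s` the first player plays the set `good s ∈ U` and an answer `n` leads to the state
`next s n`, then the second player can answer along an enumeration of a member of `U`. -/
theorem IsSelective.exists_play {U : Ultrafilter ℕ} (hU : IsSelective U) {S : Type*} (s₀ : S)
    (good : S → Set ℕ) (hgood : ∀ s, good s ∈ U) (next : S → ℕ → S) :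
    ∃ a : ℕ → ℕ, StrictMono a ∧ Set.range a ∈ U ∧ ∃ s : ℕ → S, s 0 = s₀ ∧
      ∀ k, a k ∈ good (s k) ∧ s (k + 1) = next (s k) (a k) := by
  -- `F m` is the finite set of states reachable by increasing answers below `m`; a diagonal
  -- intersection handles all of them at once.
  let F : ℕ → Set S := fun m => Nat.rec {s₀} (fun m E => E ∪ (next · m) '' E) m
  have hFs : ∀ m, F (m + 1) = F m ∪ (next · m) '' F m := fun m => rfl
  have hFfin : ∀ m, (F m).Finite := fun m => by
    induction m with
    | zero => exact Set.finite_singleton s₀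
    | succ m ih => rw [hFs]; exact ih.union (ih.image _)
  have hFmono : Monotone F := monotone_nat_of_le_succ fun m => by
    rw [hFs]; exact Set.subset_union_left
  obtain ⟨A, hA, hAB⟩ := hU.exists_diagonal (B := fun m => ⋂ s ∈ F (m + 1), good s)
    fun m => (Filter.biInter_mem (f := (U : Filter ℕ)) (hFfin (m + 1))).2 fun s _ => hgood s
  set A' := A ∩ good s₀ with hA'
  have hA'U : A' ∈ U := Filter.inter_mem hA (hgood s₀)
  have hinf : (Set.ofPred (· ∈ A')).Infinite := hU.infinite hA'U
  set a := Nat.nth (· ∈ A') with ha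
  have hmono : StrictMono a := Nat.nth_strictMono hinf
  have hmem : ∀ k, a k ∈ A' := fun k => Nat.nth_mem_of_infinite hinf k
  have hran : Set.range a = A' := Nat.range_nth_of_infinite hinf
  let s : ℕ → S := fun k => Nat.rec s₀ (fun k t => next t (a k)) k
  have hsF : ∀ k, s k ∈ F (a k) ∧ s (k + 1) ∈ F (a k + 1) := fun k => by
    have key : ∀ k, s k ∈ F (a k) → s (k + 1) ∈ F (a k + 1) := fun k hk => by
      rw [hFs]; exact Or.inr ⟨s k, hk, rfl⟩
    have : s k ∈ F (a k) := by
      induction k with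
      | zero => exact hFmono (Nat.zero_le _) (Set.mem_singleton s₀)
      | succ k ih => exact hFmono (hmono (Nat.lt_succ_self k)) (key k ih)
    exact ⟨this, key k this⟩
  refine ⟨a, hmono, hran ▸ hA'U, s, rfl, fun k => ⟨?_, rfl⟩⟩
  cases k with
  | zero => exact (hmem 0).2
  | succ k =>
    exact Set.mem_iInter₂.1 (hAB _ (hmem k).1 _ (hmem (k + 1)).1 (hmono (Nat.lt_succ_self k)))
      _ (hsF k).2

/-! ### Characters of the torus and Kronecker's theorem -/

/-- The pairing of the free Abelian group on `ι` with its dual, the torus `ι → ℝ/ℤ`. -/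
noncomputable def torusPairing {ι : Type*} (g : ι →₀ ℤ) (θ : ι → UnitAddCircle) : UnitAddCircle :=
  Finsupp.linearCombination ℤ θ g

section torusPairing

variable {ι : Type*}

theorem torusPairing_eq_sum (g : ι →₀ ℤ) (θ : ι → UnitAddCircle) :
    torusPairing g θ = ∑ i ∈ g.support, g i • θ i := rfl

theorem continuous_torusPairing (g : ι →₀ ℤ) : Continuous (torusPairing g) := by
  simp only [funext (torusPairing_eq_sum g)]
  fun_prop

theorem torusPairing_add_right (g : ι →₀ ℤ) (θ η : ι → UnitAddCircle) :
    torusPairing g (θ + η) = torusPairing g θ + torusPairing g η := by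
  simp only [torusPairing_eq_sum, Pi.add_apply, smul_add, Finset.sum_add_distrib]

theorem torusPairing_single (i : ι) (θ : ι → UnitAddCircle) :
    torusPairing (Finsupp.single i 1) θ = θ i := by
  simp [torusPairing]

/-- The torus separates the points of the free Abelian group. -/
theorem exists_torusPairing_ne_zero {g : ι →₀ ℤ} (hg : g ≠ 0) : ∃ θ, torusPairing g θ ≠ 0 := by
  classical
  obtain ⟨i, hi⟩ := Finsupp.ne_iff.1 hg
  have hi' : g i ≠ 0 := by simpa using hi
  have hr : (g i : ℝ) ≠ 0 := by exact_mod_cast hi'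
  refine ⟨Pi.single i (((1 / (2 * g i) : ℝ)) : UnitAddCircle), ?_⟩
  rw [torusPairing_eq_sum, Finset.sum_eq_single i]
  · rw [Pi.single_eq_same, ← AddCircle.coe_zsmul, zsmul_eq_mul,
      show (g i : ℝ) * (1 / (2 * g i)) = 1 / 2 by field_simp]
    intro h
    obtain ⟨n, hn⟩ := (AddCircle.coe_eq_zero_iff (1 : ℝ)).1 h
    have h2 : (n * 2 : ℝ) = 1 := by
      rw [zsmul_eq_mul] at hn
      linarith
    have h3 : n * 2 = 1 := by exact_mod_cast h2
    omega
  · intro j _ hj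
    rw [Pi.single_eq_of_ne hj, smul_zero]
  · intro h
    exact absurd (Finsupp.mem_support_iff.2 hi') h

/-- Evaluating a character of `(ℝ/ℤ)^J` at a tuple of values of the pairing. -/
theorem mFourier_torusPairing {J : Type*} [Fintype J] (k : J → ℤ) (w : J → ι →₀ ℤ)
    (θ : ι → UnitAddCircle) :
    UnitAddTorus.mFourier k (fun j => torusPairing (w j) θ) =
      fourier 1 (torusPairing (∑ j, k j • w j) θ) := by
  have h1 : torusPairing (∑ j, k j • w j) θ = ∑ j, k j • torusPairing (w j) θ := by
    simp [torusPairing]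
  have h2 : ∀ s : Finset J, ∏ j ∈ s, fourier (k j) (torusPairing (w j) θ) =
      fourier 1 (∑ j ∈ s, k j • torusPairing (w j) θ) := fun s => by
    classical
    induction s using Finset.induction_on with
    | empty => simp
    | insert j s hj ih =>
      rw [Finset.prod_insert hj, Finset.sum_insert hj, ih]
      simp [fourier_apply, AddCircle.toCircle_add]
  rw [h1, ← h2]
  rfl

open MeasureTheory

/-- The integral of a nontrivial character over the torus vanishes. -/
theorem integral_fourier_torusPairing [MeasurableSpace (ι → UnitAddCircle)]
    [BorelSpace (ι → UnitAddCircle)] (μ : Measure (ι → UnitAddCircle)) [μ.IsAddLeftInvariant]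
    {g : ι →₀ ℤ} (hg : g ≠ 0) : ∫ θ, (fourier 1 (torusPairing g θ) : ℂ) ∂μ = 0 := by
  obtain ⟨η, hη⟩ := exists_torusPairing_ne_zero hg
  -- Translation by `η` preserves the integral but multiplies it by a number different from 1.
  have h1 := integral_add_left_eq_self (μ := μ)
    (fun θ => (fourier 1 (torusPairing g θ) : ℂ)) η
  have h2 : ∀ θ, (fourier 1 (torusPairing g (η + θ)) : ℂ) =
      fourier 1 (torusPairing g η) * fourier 1 (torusPairing g θ) := fun θ => by
    simp [torusPairing_add_right, fourier_apply, AddCircle.toCircle_add]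
  simp only [h2] at h1
  rw [integral_const_mul] at h1
  by_contra h0
  have h3 : (fourier 1 (torusPairing g η) : ℂ) = 1 := by
    have := mul_eq_right₀ h0 |>.1 h1
    exact this
  rw [fourier_one] at h3
  have h4 : AddCircle.toCircle (torusPairing g η) = AddCircle.toCircle (0 : UnitAddCircle) := by
    rw [AddCircle.toCircle_zero]
    exact Subtype.ext h3
  exact hη (AddCircle.injective_toCircle one_ne_zero h4)

/-- A form of Kronecker's theorem: if finitely many sequences in a free Abelian group have no
nontrivial integral relation along the filter `l`, then along `l` they map the torus onto
denser and denser subsets of `(ℝ/ℤ)^J`. -/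
theorem eventually_exists_torusPairing_mem {J α : Type*} [Fintype J] {l : Filter α}
    (w : J → α → ι →₀ ℤ) (hw : ∀ k : J → ℤ, k ≠ 0 → ∀ᶠ n in l, ∑ j, k j • w j n ≠ 0)
    {W : Set (UnitAddTorus J)} (hW : IsOpen W) (hne : W.Nonempty) :
    ∀ᶠ n in l, ∃ θ : ι → UnitAddCircle, (fun j => torusPairing (w j n) θ) ∈ W := by
  classical
  obtain ⟨x₀, hx₀⟩ := hne
  let _ : MeasurableSpace (ι → UnitAddCircle) := borel _
  have : BorelSpace (ι → UnitAddCircle) := ⟨rfl⟩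
  let μ : Measure (ι → UnitAddCircle) := Measure.addHaarMeasure ⊤
  have hμ : IsProbabilityMeasure μ := ⟨Measure.addHaarMeasure_self (K₀ := ⊤)⟩
  let ν : Measure (J → UnitAddCircle) := Measure.addHaarMeasure ⊤
  have hν : IsProbabilityMeasure ν := ⟨Measure.addHaarMeasure_self (K₀ := ⊤)⟩
  obtain ⟨f, hf0, hf1, hf01⟩ := exists_continuous_zero_one_of_isClosed
    (X := J → UnitAddCircle) hW.isClosed_compl
    (isClosed_singleton (x := x₀)) (Set.disjoint_singleton_right.2 fun h => h hx₀)
  have hpos : 0 < ∫ x, f x ∂ν :=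
    f.continuous.integral_pos_of_hasCompactSupport_nonneg_nonzero
      (HasCompactSupport.of_compactSpace _) (fun x => (hf01 x).1)
      (x := x₀) (by rw [hf1 rfl]; exact one_ne_zero)
  set I := ∫ x, f x ∂ν with hI
  let F : C(UnitAddTorus J, ℂ) := ⟨fun x => (f x : ℂ), by fun_prop⟩
  have hF : F ∈ (Submodule.span ℂ (Set.range (UnitAddTorus.mFourier (d := J)))).topologicalClosure := by
    rw [UnitAddTorus.span_mFourier_closure_eq_top]; trivial
  -- If `W` were missed, the integral of `P` would be within `I / 3` of both 0 and `I`.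
  obtain ⟨P, hP, hPF⟩ := Metric.mem_closure_iff.1 hF (I / 3) (by positivity)
  obtain ⟨a, rfl⟩ := (Finsupp.mem_span_range_iff_exists_finsupp).1 hP
  set P := a.sum fun k z => z • UnitAddTorus.mFourier k with hPdef
  have hPapp : ∀ x, P x = ∑ k ∈ a.support, a k * UnitAddTorus.mFourier k x := fun x => by
    simp [hPdef, Finsupp.sum, ContinuousMap.sum_apply]
  have hev : ∀ᶠ n in l, ∀ k ∈ a.support, k ≠ 0 → ∑ j, k j • w j n ≠ 0 := by
    refine (Filter.eventually_all_finset _).2 fun k _ => ?_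
    by_cases hk : k = 0
    · exact Filter.Eventually.of_forall fun _ h => absurd hk h
    · exact (hw k hk).mono fun _ h _ => h
  filter_upwards [hev] with n hn
  by_contra! hcon
  let Φ : (ι → UnitAddCircle) → UnitAddTorus J := fun θ j => torusPairing (w j n) θ
  have hΦ : Continuous Φ := continuous_pi fun j => continuous_torusPairing _
  have hint : ∀ k ∈ a.support, ∫ θ, (UnitAddTorus.mFourier k (Φ θ) : ℂ) ∂μ =
      ∫ x, (UnitAddTorus.mFourier k x : ℂ) ∂ν := fun k hk => by
    by_cases hk0 : k = 0
    · subst hk0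
      simp [UnitAddTorus.mFourier_zero]
    · have h1 : ∫ θ, (UnitAddTorus.mFourier k (Φ θ) : ℂ) ∂μ = 0 := by
        simp only [Φ, mFourier_torusPairing]
        exact integral_fourier_torusPairing μ (hn k hk hk0)
      have h2 : ∫ x, (UnitAddTorus.mFourier k x : ℂ) ∂ν = 0 := by
        have h3 : ∀ x : J → UnitAddCircle, UnitAddTorus.mFourier k x =
            fourier 1 (torusPairing (∑ j, k j • Finsupp.single j 1) x) := fun x => by
          rw [← mFourier_torusPairing]
          simp only [torusPairing_single]
        simp only [h3]
        refine integral_fourier_torusPairing ν fun h => hk0 ?_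
        ext j
        have := DFunLike.congr_fun h j
        simpa [Finsupp.single_apply] using this
      rw [h1, h2]
  have hPint : ∫ θ, P (Φ θ) ∂μ = ∫ x, P x ∂ν := by
    simp only [hPapp]
    rw [integral_finsetSum, integral_finsetSum]
    · refine Finset.sum_congr rfl fun k hk => ?_
      rw [integral_const_mul, integral_const_mul, hint k hk]
    · exact fun k _ => Continuous.integrable_of_hasCompactSupport (by fun_prop)
        (HasCompactSupport.of_compactSpace _)
    · exact fun k _ => Continuous.integrable_of_hasCompactSupport (by fun_prop)
        (HasCompactSupport.of_compactSpace _)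
  have hbound : ∀ x, ‖F x - P x‖ ≤ I / 3 := fun x => by
    rw [← dist_eq_norm]
    exact (ContinuousMap.dist_apply_le_dist x).trans hPF.le
  have hF0 : ∀ θ, F (Φ θ) = 0 := fun θ => by
    have : f (Φ θ) = 0 := hf0 (hcon θ)
    simp [F, this]
  have h1 : ‖∫ θ, P (Φ θ) ∂μ‖ ≤ I / 3 := by
    refine (norm_integral_le_of_norm_le_const (C := I / 3) (Filter.Eventually.of_forall
      fun θ => ?_)).trans (by simp)
    simpa [hF0] using hbound (Φ θ)
  have h2 : ‖∫ x, (F x - P x) ∂ν‖ ≤ I / 3 :=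
    (norm_integral_le_of_norm_le_const (C := I / 3) (Filter.Eventually.of_forall
      fun x => hbound x)).trans (by simp)
  have hFint : Integrable (fun x => F x) ν :=
    F.continuous.integrable_of_hasCompactSupport (HasCompactSupport.of_compactSpace _)
  have hPint' : Integrable (fun x => P x) ν :=
    P.continuous.integrable_of_hasCompactSupport (HasCompactSupport.of_compactSpace _)
  have h3 : ∫ x, F x ∂ν = (I : ℂ) := integral_ofReal
  rw [integral_sub hFint hPint', h3, ← hPint] at h2
  have h4 : ‖(I : ℂ)‖ ≤ I / 3 + I / 3 := by
    calc ‖(I : ℂ)‖ = ‖((I : ℂ) - ∫ θ, P (Φ θ) ∂μ) + ∫ θ, P (Φ θ) ∂μ‖ := by rw [sub_add_cancel]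
      _ ≤ _ := (norm_add_le _ _).trans (add_le_add h2 h1)
  rw [Complex.norm_real, Real.norm_of_nonneg hpos.le] at h4
  linarith

end torusPairing

/-! ### Construction of the point of the torus -/

/-- Refinement step: inside a nonempty open set of the torus one finds, for almost all `n`, a
smaller one on whose closure finitely many sequences `u p` are close to their targets `c p`. -/
theorem eventually_exists_open_refinement {ι : Type*} {l : Filter ℕ} (u : ℕ → ℕ → ι →₀ ℤ)
    (c : ℕ → ι →₀ ℤ)
    (hu : ∀ (s : Finset ℕ) (k : ℕ → ℤ) (g : ι →₀ ℤ), ((∃ p ∈ s, k p ≠ 0) ∨ g ≠ 0) →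
      ∀ᶠ n in l, ∑ p ∈ s, k p • u p n + g ≠ 0)
    {V : Set (ι → UnitAddCircle)} (hV : IsOpen V) (hne : V.Nonempty) (m : ℕ) {ε : ℝ}
    (hε : 0 < ε) :
    ∀ᶠ n in l, ∃ V' : Set (ι → UnitAddCircle), IsOpen V' ∧ V'.Nonempty ∧ closure V' ⊆ V ∧
      ∀ θ ∈ closure V', ∀ p < m, dist (torusPairing (u p n) θ) (torusPairing (c p) θ) < ε := by
  classical
  obtain ⟨θ₀, hθ₀⟩ := hne
  set O : Set (ι → UnitAddCircle) := V ∩ ⋂ p ∈ Finset.range m,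
    {θ | dist (torusPairing (c p) θ) (torusPairing (c p) θ₀) < ε / 2} with hO
  have hOo : IsOpen O := hV.inter <| isOpen_biInter_finset fun p _ =>
    isOpen_lt ((continuous_torusPairing _).dist continuous_const) continuous_const
  have hθO : θ₀ ∈ O := ⟨hθ₀, by simp [hε]⟩
  -- Only the finitely many coordinates in `E` matter for staying in `O`; they enter `w` as constant
  -- sequences.
  obtain ⟨E, v, hv, hvO⟩ := isOpen_pi_iff.1 hOo θ₀ hθO
  let w : E ⊕ Fin m → ℕ → ι →₀ ℤ :=
    Sum.elim (fun i _ => Finsupp.single i.1 1) (fun p n => u p n)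
  let W : Set (UnitAddTorus (E ⊕ Fin m)) := Set.univ.pi
    (Sum.elim (fun i => v i) (fun p => Metric.ball (torusPairing (c p) θ₀) (ε / 2)))
  have hW : IsOpen W := by
    refine isOpen_set_pi Set.finite_univ ?_
    rintro (i | p) -
    · exact (hv i i.2).1
    · exact Metric.isOpen_ball
  have hWne : W.Nonempty := by
    refine ⟨Sum.elim (fun i => θ₀ i) (fun p => torusPairing (c p) θ₀), ?_⟩
    rintro (i | p) -
    · exact (hv i i.2).2
    · exact Metric.mem_ball_self (by positivity)
  have hw : ∀ k : E ⊕ Fin m → ℤ, k ≠ 0 → ∀ᶠ n in l, ∑ j, k j • w j n ≠ 0 := fun k hk => by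
    let k' : ℕ → ℤ := fun p => if hp : p < m then k (Sum.inr ⟨p, hp⟩) else 0
    let g : ι →₀ ℤ := ∑ i : E, k (Sum.inl i) • Finsupp.single i.1 1
    have hg : ∀ i : E, g i.1 = k (Sum.inl i) := fun i => by
      simp only [g, Finsupp.finsetSum_apply, Finsupp.smul_apply]
      rw [Finset.sum_eq_single i]
      · simp
      · intro j _ hj
        rw [Finsupp.single_eq_of_ne fun h => hj (Subtype.ext h.symm), smul_zero]
      · exact fun h => absurd (Finset.mem_univ i) h
    have hor : (∃ p ∈ Finset.range m, k' p ≠ 0) ∨ g ≠ 0 := by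
      by_contra! hcon
      refine hk (funext ?_)
      rintro (i | p)
      · rw [← hg, hcon.2]; rfl
      · simpa [k'] using hcon.1 p (Finset.mem_range.2 p.2)
    filter_upwards [hu (Finset.range m) k' g hor] with n hn
    convert hn using 1
    rw [Fintype.sum_sum_type, add_comm, Finset.sum_range]
    simp [w, k', g]
  filter_upwards [eventually_exists_torusPairing_mem w hw hW hWne] with n ⟨θ, hθ⟩
  have hθE : ∀ i ∈ E, θ i ∈ v i := fun i hi => by
    have := hθ (Sum.inl ⟨i, hi⟩) trivial
    simpa [w, torusPairing_single] using this
  have hθp : ∀ p < m, dist (torusPairing (u p n) θ) (torusPairing (c p) θ₀) < ε / 2 :=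
    fun p hp => hθ (Sum.inr ⟨p, hp⟩) trivial
  have hθO : θ ∈ O := hvO hθE
  set N : Set (ι → UnitAddCircle) := V ∩ ⋂ p ∈ Finset.range m,
    {θ | dist (torusPairing (u p n) θ) (torusPairing (c p) θ) < ε} with hN
  have hNo : IsOpen N := hV.inter <| isOpen_biInter_finset fun p _ =>
    isOpen_lt ((continuous_torusPairing _).dist (continuous_torusPairing _)) continuous_const
  have hθN : θ ∈ N := by
    refine ⟨hθO.1, Set.mem_iInter₂.2 fun p hp => ?_⟩
    have h1 := hθp p (Finset.mem_range.1 hp)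
    have h2 : dist (torusPairing (c p) θ) (torusPairing (c p) θ₀) < ε / 2 :=
      Set.mem_iInter₂.1 hθO.2 p hp
    have h3 := dist_triangle_right (torusPairing (u p n) θ) (torusPairing (c p) θ)
      (torusPairing (c p) θ₀)
    exact h3.trans_lt (by linarith)
  obtain ⟨C, ⟨hC, hCc⟩, hCN⟩ := (closed_nhds_basis θ).mem_iff.1 (hNo.mem_nhds hθN)
  have hcl : closure (interior C) ⊆ N := (closure_minimal interior_subset hCc).trans hCN
  refine ⟨interior C, isOpen_interior, ⟨θ, mem_interior_iff_mem_nhds.2 hC⟩,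
    hcl.trans Set.inter_subset_left, fun η hη p hp => ?_⟩
  exact Set.mem_iInter₂.1 (hcl hη).2 p (Finset.mem_range.2 hp)

/-- The homomorphism theorem for free Abelian groups, in terms of points of the dual torus. -/
theorem IsSelective.exists_torusPairing_tendsto {U : Ultrafilter ℕ} (hU : IsSelective U)
    {ι : Type*} (u : ℕ → ℕ → ι →₀ ℤ) (c : ℕ → ι →₀ ℤ)
    (hu : ∀ (s : Finset ℕ) (k : ℕ → ℤ) (g : ι →₀ ℤ), ((∃ p ∈ s, k p ≠ 0) ∨ g ≠ 0) →
      ∀ᶠ n in (U : Filter ℕ), ∑ p ∈ s, k p • u p n + g ≠ 0)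
    {c₀ : ι →₀ ℤ} (hc₀ : c₀ ≠ 0) :
    ∃ θ : ι → UnitAddCircle, torusPairing c₀ θ ≠ 0 ∧
      ∀ p, Filter.Tendsto (fun n => torusPairing (u p n) θ) (U : Filter ℕ)
        (nhds (torusPairing (c p) θ)) := by
  classical
  let S := {V : Set (ι → UnitAddCircle) // IsOpen V ∧ V.Nonempty} × ℕ
  let Refines : S → ℕ → {V : Set (ι → UnitAddCircle) // IsOpen V ∧ V.Nonempty} → Prop :=
    fun s n V' => closure V'.1 ⊆ s.1.1 ∧ ∀ θ ∈ closure V'.1, ∀ p < s.2,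
      dist (torusPairing (u p n) θ) (torusPairing (c p) θ) < 1 / (s.2 + 1 : ℝ)
  let good : S → Set ℕ := fun s => {n | ∃ V', Refines s n V'}
  have hgood : ∀ s, good s ∈ U := fun s => by
    have h1 := eventually_exists_open_refinement u c hu s.1.2.1 s.1.2.2 s.2
      (ε := 1 / (s.2 + 1 : ℝ)) (by positivity)
    exact h1.mono fun n ⟨V', ho, hne, h⟩ => ⟨⟨V', ho, hne⟩, h⟩
  let next : S → ℕ → S := fun s n =>
    -- The default `s` never occurs along the play, whose answers are all good.
    if hn : ∃ V', Refines s n V' then (hn.choose, s.2 + 1) else s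
  have hnext : ∀ s n, n ∈ good s → Refines s n (next s n).1 ∧ (next s n).2 = s.2 + 1 :=
    fun s n hn => by
      have hn' : ∃ V', Refines s n V' := hn
      simp only [next, dif_pos hn']
      exact ⟨hn'.choose_spec, trivial⟩
  let V₀ : {V : Set (ι → UnitAddCircle) // IsOpen V ∧ V.Nonempty} :=
    ⟨{θ | torusPairing c₀ θ ≠ 0}, isOpen_ne_fun (continuous_torusPairing _) continuous_const,
      exists_torusPairing_ne_zero hc₀⟩
  obtain ⟨a, hamono, haU, s, hs0, hs⟩ := hU.exists_play (V₀, 0) good hgood next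
  have hstep : ∀ k, Refines (s k) (a k) (s (k + 1)).1 ∧ (s (k + 1)).2 = (s k).2 + 1 := fun k => by
    rw [(hs k).2]; exact hnext _ _ (hs k).1
  have hstage : ∀ k, (s k).2 = k := fun k => by
    induction k with
    | zero => rw [hs0]
    | succ k ih => rw [(hstep k).2, ih]
  -- The shift to `k + 1` matters: the closure at stage 1 lies in `V₀`, whereas the closure of `V₀`
  -- may contain points killing `c₀`.
  obtain ⟨θ, hθ⟩ := IsCompact.nonempty_iInter_of_sequence_nonempty_isCompact_isClosed
    (fun k => closure (s (k + 1)).1.1)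
    (fun k => (hstep (k + 1)).1.1.trans subset_closure)
    (fun k => (s (k + 1)).1.2.2.closure) isClosed_closure.isCompact (fun _ => isClosed_closure)
  rw [Set.mem_iInter] at hθ
  refine ⟨θ, ?_, fun p => ?_⟩
  · have h1 := (hstep 0).1.1 (hθ 0)
    rw [hs0] at h1
    exact h1
  · rw [Metric.tendsto_nhds]
    intro ε hε
    obtain ⟨K, hK⟩ := exists_nat_one_div_lt hε
    have hfin : ((a '' Set.Iio (max K (p + 1)))ᶜ : Set ℕ) ∈ U :=
      hU.compl_mem_of_finite ((Set.finite_Iio _).image a)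
    filter_upwards [haU, hfin] with n hn hn'
    obtain ⟨k, rfl⟩ := hn
    have hk : max K (p + 1) ≤ k := not_lt.1 fun h => hn' ⟨k, h, rfl⟩
    have h1 := (hstep k).1.2 θ (hθ k) p (by rw [hstage]; omega)
    rw [hstage] at h1
    refine h1.trans (lt_of_le_of_lt ?_ hK)
    have : (K : ℝ) ≤ k := by exact_mod_cast (le_max_left _ _).trans hk
    gcongr

/-! ### From independence in the ultrapower to the theorem -/

/-- In a family witnessing `IndependentPermutations`, a nontrivial integral combination of
finitely many of the sequences and of a constant is nonzero for almost all indices. -/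
theorem IndependentPermutations.eventually_sum_add_ne_zero {U : Ultrafilter ℕ}
    {h : BelowContPos → ℕ → FreeAbCont} {σ : BelowContPos → Equiv.Perm ℕ}
    (hσ : IndependentPermutations U h σ) {u : ℕ → ℕ → FreeAbCont}
    (hu : ∀ p, ∃ ξ, u p = h ξ ∘ σ ξ) (hu_inj : Function.Injective u)
    (s : Finset ℕ) (k : ℕ → ℤ) (g : FreeAbCont) (hkg : (∃ p ∈ s, k p ≠ 0) ∨ g ≠ 0) :
    ∀ᶠ n in (U : Filter ℕ), ∑ p ∈ s, k p • u p n + g ≠ 0 := by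
  classical
  choose ξ hξ using hu
  -- Although `h` may repeat, distinct `u p` need distinct indices, so they form a subfamily of the
  -- independent family.
  have hξinj : Function.Injective ξ := fun p q hpq => hu_inj (by rw [hξ, hξ, hpq])
  have hli := LinearIndependent.comp hσ (Sum.map ξ id)
    (Sum.map_injective.2 ⟨hξinj, Function.injective_id⟩)
  rw [linearIndependent_iff'] at hli
  by_contra hcon
  have hev : ∀ᶠ n in (U : Filter ℕ), ∑ p ∈ s, k p • u p n + g = 0 :=
    (Ultrafilter.eventually_not.not_left.1 hcon)
  have hrat : ∀ᶠ n in (U : Filter ℕ), ∑ p ∈ s, (k p : ℚ) • toRat (u p n) +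
      ∑ β ∈ g.support, (g β : ℚ) • toRat (Finsupp.single β 1) = 0 := hev.mono fun n hn => by
    have h1 := congrArg toRat hn
    rw [map_add, map_sum, map_zero] at h1
    have h2 : toRat g = ∑ β ∈ g.support, (g β : ℚ) • toRat (Finsupp.single β 1) := by
      conv_lhs => rw [← Finsupp.sum_single g, Finsupp.sum, map_sum]
      refine Finset.sum_congr rfl fun β _ => ?_
      rw [Int.cast_smul_eq_zsmul, ← map_zsmul, Finsupp.smul_single, smul_eq_mul, mul_one]
    rw [← h2, ← h1]
    congr 1
    refine Finset.sum_congr rfl fun p _ => ?_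
    rw [Int.cast_smul_eq_zsmul, ← map_zsmul]
  have hzero := hli (s.disjSum g.support)
    (Sum.elim (fun p => (k p : ℚ)) (fun β => (g β : ℚ))) (by
      rw [Finset.sum_disjSum]
      have h1 : ∑ p ∈ s, (k p : ℚ) • ultraClass U (u p) +
          ∑ β ∈ g.support, (g β : ℚ) • ultraClass U (fun _ => Finsupp.single β 1) =
          Filter.Germ.coeAddHom (U : Filter ℕ) (∑ p ∈ s, (fun n => (k p : ℚ) • toRat (u p n)) +
            ∑ β ∈ g.support, (fun _ => (g β : ℚ) • toRat (Finsupp.single β 1))) := by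
        rw [map_add, map_sum, map_sum]
        rfl
      have h2 : Filter.Germ.coeAddHom (U : Filter ℕ)
          (∑ p ∈ s, (fun n => (k p : ℚ) • toRat (u p n)) +
            ∑ β ∈ g.support, (fun _ => (g β : ℚ) • toRat (Finsupp.single β 1))) = 0 := by
        refine Filter.Germ.coe_eq.2 (hrat.mono fun n hn => ?_)
        simpa [Finset.sum_apply] using hn
      rw [← h2, ← h1]
      simp [hξ])
  rcases hkg with ⟨p, hp, hkp⟩ | hg
  · have : (k p : ℚ) = 0 := hzero (Sum.inl p) (Finset.inl_mem_disjSum.2 hp)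
    exact hkp (by exact_mod_cast this)
  · refine hg (Finsupp.ext fun β => ?_)
    by_contra hβ
    have : (g β : ℚ) = 0 := hzero (Sum.inr β) (Finset.inr_mem_disjSum.2 (Finsupp.mem_support_iff.2 hβ))
    exact hβ (by exact_mod_cast this)

theorem mainTheorem3 (U : Ultrafilter ℕ) (hU : IsSelective U)
    (h : BelowContPos → ℕ → FreeAbCont) (hh : IsEnumeration h)
    (σ : BelowContPos → Equiv.Perm ℕ) (hσ : IndependentPermutations U h σ)
    (c : FreeAbCont) (hc : c ≠ 0)
    (cp : ℕ → FreeAbCont) (hcp : ∀ p, cp p ≠ 0)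
    (u : ℕ → ℕ → FreeAbCont) (hu : ∀ p, ∃ ξ, u p = h ξ ∘ σ ξ) (hu_inj : Function.Injective u)
    (T : Set BelowCont) (hT : T.Countable)
    (hcT : c ∈ FreeAbOn T) (hcpT : ∀ p, cp p ∈ FreeAbOn T) (huT : ∀ p n, u p n ∈ FreeAbOn T) :
    ∃ Λ : FreeAbOn T →+ UnitAddCircle,
      Λ ⟨c, hcT⟩ ≠ 0 ∧
      ∀ p, Filter.Tendsto (fun n => Λ ⟨u p n, huT p n⟩) (U : Filter ℕ)
        (nhds (Λ ⟨cp p, hcpT p⟩)) := by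

  classical
  let e : FreeAbOn T ≃ₗ[ℤ] (T →₀ ℤ) := Finsupp.supportedEquivFinsupp T
  have he : ∀ x, e x = 0 ↔ x = 0 := fun x => e.map_eq_zero_iff
  have hind : ∀ (s : Finset ℕ) (k : ℕ → ℤ) (g : T →₀ ℤ), ((∃ p ∈ s, k p ≠ 0) ∨ g ≠ 0) →
      ∀ᶠ n in (U : Filter ℕ), ∑ p ∈ s, k p • e ⟨u p n, huT p n⟩ + g ≠ 0 := fun s k g hkg => by
    have hkg' : (∃ p ∈ s, k p ≠ 0) ∨ (e.symm g : FreeAbCont) ≠ 0 :=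
      hkg.imp_right fun hg h0 => hg (e.symm.map_eq_zero_iff.1 (Subtype.ext h0))
    refine (hσ.eventually_sum_add_ne_zero hu hu_inj s k _ hkg').mono fun n hn h0 => hn ?_
    have h1 := congrArg (fun x => (e.symm x : FreeAbCont)) h0
    simpa using h1
  obtain ⟨θ, hθc, hθ⟩ := hU.exists_torusPairing_tendsto (fun p n => e ⟨u p n, huT p n⟩)
    (fun p => e ⟨cp p, hcpT p⟩) hind (c₀ := e ⟨c, hcT⟩)
    fun h0 => hc (congrArg Subtype.val ((he _).1 h0))
  exact ⟨((Finsupp.linearCombination ℤ θ).comp e.toLinearMap).toAddMonoidHom, hθc, hθ⟩
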